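/- A stochastic graph $G=(U,V,E)$ is a finite bipartite graph with offline vertices $U$, online vertices $V$, edges $E\subseteq U\times V$, real edge weights $(w_e)_{e\in E}$ and edge probabilities $(p_e)_{e\in E}$, $p_e\in[0,1]$; each edge $e$ is active independently with probability $p_e$. Write $\partial(r)$ for the set of edges at a vertex $r$, and $\partial(v)^{(*)}$ for the set of strings (including the empty string) of pairwise distinct edges of $\partial(v)$. Each $v\in V$ has a probing constraint $\mathcal C_v\subseteq\partial(v)^{(*)}$ that is closed under substrings and permutations; $G$ is unconstrained (has unbounded patience) if $\mathcal C_v=\partial(v)^{(*)}$ for every $v\in V$. For a string $\mathbf e$ let $q(\mathbf e)=\prod_{f\in\mathbf e}(1-p_f)$, let $\mathbf e_{<f}$ be the part of $\mathbf e$ strictly before $f$, and let $\mathrm{val}(\mathbf e)=\sum_{f\in\mathbf e}w_f\,p_f\,q(\mathbf e_{<f})$. LP-config is: maximize $\sum_{v\in V}\sum_{\mathbf e\in\mathcal C_v}\mathrm{val}(\mathbf e)\,x_v(\mathbf e)$ subject to $$\sum_{v\in V}\ \sum_{\mathbf e\in\mathcal C_v:\,(u,v)\in\mathbf e}p_{u,v}\,q(\mathbf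 e_{<(u,v)})\,x_v(\mathbf e)\le 1\quad(u\in U),\qquad \sum_{\mathbf e\in\mathcal C_v}x_v(\mathbf e)=1\quad(v\in V),\qquad x_v(\mathbf e)\ge 0 .$$ LP-QC is: maximize $\sum_{e\in E}w_e\,p_e\,x_e$ subject to $$\sum_{e\in S}p_e x_e\le 1-\prod_{e\in S}(1-p_e)\quad(v\in V,\ S\subseteq\partial(v)),\qquad \sum_{e\in\partial(u)}p_e x_e\le 1\quad(u\in U),\qquad x_e\ge 0\quad(e\in E).$$ A relaxed probing algorithm for $G$ is a (possibly randomized) algorithm that knows $G$ but not the edge states, and that adaptively probes edges one at a time, each probe revealing whether the probed edge is active. For each $v\in V$ the string of edges of $\partial(v)$ that it probes, in order, must lie in $\mathcal C_v$. When a probed edge is active, the algorithm must irrevocably decide whether to include it in its output $\mathcal M$ before it probes any further edge, and only active probed edges may be included. Each $v\in V$ must lie in at most one edge of $\mathcal M$, and each $u\in U$ must satisfy $\mathbb E\,|\mathcal M\cap\partial(u)|\le 1$. The relaxed benchmark is a relaxed probing algorithm that maximizes $\mathbb E\big[\sum_{e\in\mathcal M}w_e\big]$, and its value $\mathrm{OPT}_{\mathrm{rel}}(G)$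 is this maximum. Proposition. If $G$ is unconstrained, then the maxima in LP-QC, in LP-config and in the definition of $\mathrm{OPT}_{\mathrm{rel}}(G)$ are all attained, and with $\mathrm{LPOPT}_{\mathrm{QC}}(G)$ and $\mathrm{LPOPT}(G)$ denoting the optimum values of LP-QC and LP-config, $$\mathrm{LPOPT}_{\mathrm{QC}}(G)=\mathrm{LPOPT}(G)=\mathrm{OPT}_{\mathrm{rel}}(G).$$ -/

import Mathlib

/-- The finite set `S^(*)` of all strings with pairwise distinct characters, all taken from `S`. -/
def distinctStrings {α : Type*} [Fintype α] [DecidableEq α] (S : Finset α) : Finset (List α) :=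
  ((Finset.univ : Finset {l : List α // l.Nodup}).image Subtype.val).filter
    (fun l => ∀ f ∈ l, f ∈ S)

theorem mem_distinctStrings {α : Type*} [Fintype α] [DecidableEq α] {S : Finset α} {l : List α} :
    l ∈ distinctStrings S ↔ l.Nodup ∧ ∀ f ∈ l, f ∈ S := by
  simp [distinctStrings]

/-- A stochastic graph: a bipartite graph on the offline vertices `U` and the online vertices `V`
with edge set `E`, edge weights `w`, edge probabilities `p`, and for each online vertex `v` a
downward-closed probing constraint `C v` (closed under substrings and permutations) on the strings
of distinct edges at `v`. Values of `w` and `p` off `E` are irrelevant. -/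
structure StochasticGraph (U V : Type*) [Fintype U] [DecidableEq U] [Fintype V] [DecidableEq V] where
  E : Finset (U × V)
  w : U × V → ℝ
  p : U × V → ℝ
  p_nonneg : ∀ e ∈ E, 0 ≤ p e
  p_le_one : ∀ e ∈ E, p e ≤ 1
  C : V → Finset (List (U × V))
  C_subset : ∀ v, C v ⊆ distinctStrings (E.filter (fun e => e.2 = v))
  C_downward_closed : ∀ v, ∀ s ∈ C v, ∀ s' : List (U × V), s'.Subperm s → s' ∈ C v

/-- A deterministic adaptive probe-commit strategy, as a decision tree. At `probe e keep ifActive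
ifInactive` the edge `e` is probed. If it turns out active, it is irrevocably included in the output
if `keep = true` and irrevocably rejected otherwise, and the strategy continues with `ifActive`;
if it is inactive, the strategy continues with `ifInactive`. -/
inductive ProbingTree (α : Type*) where
  | halt : ProbingTree α
  | probe (e : α) (keep : Bool) (ifActive ifInactive : ProbingTree α) : ProbingTree α

namespace ProbingTree

variable {α : Type*} [DecidableEq α]

/-- The edges probed, in order, when the set of active edges is `A`. -/
def probes (A : Finset α) : ProbingTree α → List α
  | halt => []
  | probe e _ ifActive ifInactive =>
      e :: (if e ∈ A then probes A ifActive else probes A ifInactive)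

/-- The set of edges that is returned when the set of active edges is `A`. -/
def output (A : Finset α) : ProbingTree α → Finset α
  | halt => ∅
  | probe e keep ifActive ifInactive =>
      if e ∈ A then
        (if keep = true then insert e (output A ifActive) else output A ifActive)
      else output A ifInactive

end ProbingTree

namespace StochasticGraph

variable {U V : Type*} [Fintype U] [DecidableEq U] [Fintype V] [DecidableEq V]
variable (G : StochasticGraph U V)

/-- `∂(v)` for an online vertex `v`. -/
def edgesOn (v : V) : Finset (U × V) := G.E.filter (fun e => e.2 = v)

/-- `∂(u)` for an offline vertex `u`. -/
def edgesOff (u : U) : Finset (U × V) := G.E.filter (fun e => e.1 = u)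

/-- Unbounded patience: every string of distinct edges at `v` may be probed. -/
def Unconstrained : Prop := ∀ v, G.C v = distinctStrings (G.edgesOn v)

/-! ### The configuration linear program -/

/-- The probability that all edges of the string `s` are inactive. -/
def q (s : List (U × V)) : ℝ := (s.map (fun f => 1 - G.p f)).prod

/-- `s_{<f}`: the part of the string `s` strictly before the character `f`. -/
def before (s : List (U × V)) (f : U × V) : List (U × V) := s.takeWhile (fun g => decide (g ≠ f))

/-- The expected weight of the first active edge, if `s` is probed in order. -/
def val (s : List (U × V)) : ℝ := (s.map (fun f => G.w f * G.p f * G.q (before s f))).sum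

structure ConfigFeasible (x : V → List (U × V) → ℝ) : Prop where
  offline : ∀ u : U, ∑ v : V, ∑ s ∈ (G.C v).filter (fun s => (u, v) ∈ s),
    G.p (u, v) * G.q (before s (u, v)) * x v s ≤ 1
  online : ∀ v : V, ∑ s ∈ G.C v, x v s = 1
  nonneg : ∀ v : V, ∀ s ∈ G.C v, 0 ≤ x v s

def configObjective (x : V → List (U × V) → ℝ) : ℝ := ∑ v : V, ∑ s ∈ G.C v, G.val s * x v s

def configValues : Set ℝ := {r | ∃ x, G.ConfigFeasible x ∧ G.configObjective x = r}

/-- The optimum value of the configuration linear program. -/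
noncomputable def LPOPT : ℝ := sSup G.configValues

/-! ### The query-commit linear program -/

structure QCFeasible (x : U × V → ℝ) : Prop where
  online : ∀ v : V, ∀ S ⊆ G.edgesOn v, ∑ e ∈ S, G.p e * x e ≤ 1 - ∏ e ∈ S, (1 - G.p e)
  offline : ∀ u : U, ∑ e ∈ G.edgesOff u, G.p e * x e ≤ 1
  nonneg : ∀ e ∈ G.E, 0 ≤ x e

def qcObjective (x : U × V → ℝ) : ℝ := ∑ e ∈ G.E, G.w e * G.p e * x e

def qcValues : Set ℝ := {r | ∃ x, G.QCFeasible x ∧ G.qcObjective x = r}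

/-- The optimum value of the query-commit linear program. -/
noncomputable def LPOPTQC : ℝ := sSup G.qcValues

/-! ### The relaxed stochastic matching problem -/

/-- The probability that `A` is exactly the set of active edges, each edge `e` being active
independently with probability `p e`. -/
def stateProb (A : Finset (U × V)) : ℝ := (∏ e ∈ A, G.p e) * ∏ e ∈ G.E \ A, (1 - G.p e)

/-- A deterministic strategy is admissible if, whatever the edge states are, the string of edges
probed at each online vertex `v` lies in `C v`, and the output contains at most one edge at `v`. -/
def Admissible (T : ProbingTree (U × V)) : Prop :=
  ∀ A ⊆ G.E, ∀ v : V,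
    (T.probes A).filter (fun e => decide (e.2 = v)) ∈ G.C v ∧
    ((T.output A).filter (fun e => e.2 = v)).card ≤ 1

/-- A randomized probing algorithm is a probability distribution on deterministic strategies, drawn
independently of the edge states; this is the expectation of `f` of its output. -/
noncomputable def expect (μ : PMF (ProbingTree (U × V))) (f : Finset (U × V) → ℝ) : ℝ :=
  ∑' T, (μ T).toReal * ∑ A ∈ G.E.powerset, G.stateProb A * f (T.output A)

/-- Relaxed probing algorithms: the output is a one-sided matching of the online vertices, and each
offline vertex is matched at most once in expectation. -/
structure IsRelaxedProbingAlgorithm (μ : PMF (ProbingTree (U × V))) : Prop where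
  admissible : ∀ T ∈ μ.support, G.Admissible T
  offline : ∀ u : U, G.expect μ (fun M => ((M.filter (fun e => e.1 = u)).card : ℝ)) ≤ 1

def relaxedValues : Set ℝ :=
  {r | ∃ μ, G.IsRelaxedProbingAlgorithm μ ∧ G.expect μ (fun M => ∑ e ∈ M, G.w e) = r}

/-- The value of the relaxed benchmark. -/
noncomputable def OPTrel : ℝ := sSup G.relaxedValues

end StochasticGraph

/-! The sets of values of the three problems coincide: `configValues` ⊆ `relaxedValues` ⊆ `qcValues`
⊆ `configValues`. In each problem the objective and the offline constraints depend only on the edge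
marginals, i.e. the probabilities with which each edge is returned, so each inclusion transports
marginals exactly.

Config to relaxed (`exists_relaxed_of_configFeasible`): draw a string for every online vertex
independently from `x v`, probe it in order and keep the first active edge.

Relaxed to query-commit (`relaxedValues_subset_qcValues`): divide the return probability of an edge
by its activation probability. At most one edge of `S ⊆ ∂(v)` is returned, and none unless `S`
contains an active edge.

Query-commit to config (`qcValues_subset_configValues`): at a fixed `v`, the vector `p e * z e` must
be a convex combination of the first-active-edge distributions of strings at `v`. By Hahn–Banach
(`exists_convex_weights`) it suffices that every linear functional `c` is at least as large on some
string as on the vector. Such a string lists the edges with `c e ≥ 0` by decreasing `c`, the greedy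
algorithm on a polymatroid (`sum_le_sum_greedy`). Unbounded patience makes this string admissible.

Attainment is checked for the query-commit program, by compactness, and passes to the others because
the value sets are equal. -/

namespace ProbingTree

/-! ### Decision trees that probe fixed strings -/

variable {α : Type*} [DecidableEq α]

theorem output_subset (A : Finset α) (T : ProbingTree α) : T.output A ⊆ A := by
  induction T with
  | halt => simp [output]
  | probe e keep T₁ T₂ h₁ h₂ =>
    unfold output
    split_ifs with he hk
    · exact Finset.insert_subset he h₁
    · exact h₁
    · exact h₂

/-- Probe the string `s` in order, commit to its first active edge, and continue with `T`. -/
def probeThen : List α → ProbingTree α → ProbingTree α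
  | [], T => T
  | e :: s, T => probe e true T (probeThen s T)

theorem probes_probeThen (A : Finset α) (s : List α) (T : ProbingTree α) :
    ∃ t, t.Sublist s ∧ (probeThen s T).probes A = t ++ T.probes A := by
  induction s with
  | nil => exact ⟨[], List.Sublist.refl _, rfl⟩
  | cons e s ih =>
    obtain ⟨t, ht, h⟩ := ih
    by_cases he : e ∈ A
    · exact ⟨[e], by simp, by simp [probeThen, probes, he]⟩
    · exact ⟨e :: t, ht.cons_cons e, by simp [probeThen, probes, he, h]⟩

theorem mem_output_probeThen {A : Finset α} {s : List α} {T : ProbingTree α} {e : α} :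
    e ∈ (probeThen s T).output A ↔
      s.find? (fun f => decide (f ∈ A)) = some e ∨ e ∈ T.output A := by
  induction s with
  | nil => simp [probeThen]
  | cons f s ih =>
    by_cases hf : f ∈ A
    · simp [probeThen, output, hf, eq_comm]
    · simp [probeThen, output, hf, ih]

/-- Probe the strings `σ v` one after the other, with `v` ranging over a list, and commit to the
first active edge of each of them. -/
def probeAll {ι : Type*} (σ : ι → List α) : List ι → ProbingTree α
  | [] => halt
  | v :: vs => probeThen (σ v) (probeAll σ vs)

theorem mem_output_probeAll {ι : Type*} {σ : ι → List α} {vs : List ι} {A : Finset α} {e : α} :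
    e ∈ (probeAll σ vs).output A ↔
      ∃ v ∈ vs, (σ v).find? (fun f => decide (f ∈ A)) = some e := by
  induction vs with
  | nil => simp [probeAll, output]
  | cons v vs ih => simp [probeAll, mem_output_probeThen, ih]

/-- The second conjunct strengthens the induction: the head vertex receives no further probes from
the tail, so its probes form a sublist of its own string. -/
theorem filter_probes_probeAll {ι : Type*} [DecidableEq ι] {σ : ι → List α} {π : α → ι}
    (hσ : ∀ v, ∀ e ∈ σ v, π e = v) {vs : List ι} (hvs : vs.Nodup) (A : Finset α) (v : ι) :
    (((probeAll σ vs).probes A).filter (fun e => decide (π e = v))).Sublist (σ v) ∧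
      (v ∉ vs → ((probeAll σ vs).probes A).filter (fun e => decide (π e = v)) = []) := by
  induction vs with
  | nil => simp [probeAll, probes]
  | cons v' vs ih =>
    obtain ⟨hv', hvs⟩ := List.nodup_cons.mp hvs
    obtain ⟨ih₁, ih₂⟩ := ih hvs
    obtain ⟨t, ht, h⟩ := probes_probeThen A (σ v') (probeAll σ vs)
    rw [probeAll, h, List.filter_append]
    by_cases hv : v' = v
    · subst hv
      rw [ih₂ hv', List.append_nil]
      exact ⟨List.filter_sublist.trans ht, by simp⟩
    · have : t.filter (fun e => decide (π e = v)) = [] := by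
        rw [List.filter_eq_nil_iff]
        intro e he
        simpa [hσ v' e (ht.subset he)] using hv
      rw [this, List.nil_append]
      exact ⟨ih₁, fun hmem => ih₂ fun hm => hmem (List.mem_cons_of_mem _ hm)⟩

end ProbingTree

namespace StochasticGraph

variable {U V : Type*} [Fintype U] [DecidableEq U] [Fintype V] [DecidableEq V]
variable (G : StochasticGraph U V)

/-! ### Probabilities of edge states -/

theorem stateProb_nonneg {A : Finset (U × V)} (hA : A ⊆ G.E) : 0 ≤ G.stateProb A :=
  mul_nonneg (Finset.prod_nonneg fun e he => G.p_nonneg e (hA he))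
    (Finset.prod_nonneg fun e he =>
      sub_nonneg.mpr (G.p_le_one e (Finset.mem_sdiff.mp he).1))

/-- Expand a product of sums `active + inactive` over all subsets of `E`, with the active term set
to zero on `Y` and the inactive term on `X`. Exactly the states in the event survive, while factors
outside `X ∪ Y` equal 1. -/
theorem sum_stateProb_ite {X Y : Finset (U × V)} (hX : X ⊆ G.E) (hY : Y ⊆ G.E)
    (hXY : Disjoint X Y) :
    ∑ A ∈ G.E.powerset, G.stateProb A * (if X ⊆ A ∧ Disjoint A Y then 1 else 0) =
      (∏ e ∈ X, G.p e) * ∏ e ∈ Y, (1 - G.p e) := by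
  have key := Finset.prod_add (fun e => if e ∈ Y then 0 else G.p e)
    (fun e => if e ∈ X then 0 else 1 - G.p e) G.E
  have hl : ∏ e ∈ G.E, ((if e ∈ Y then 0 else G.p e) + (if e ∈ X then 0 else 1 - G.p e)) =
      (∏ e ∈ X, G.p e) * ∏ e ∈ Y, (1 - G.p e) := by
    have h₁ : ∏ e ∈ X, G.p e =
        ∏ e ∈ X, ((if e ∈ Y then 0 else G.p e) + (if e ∈ X then 0 else 1 - G.p e)) :=
      Finset.prod_congr rfl fun e he => by simp [he, Finset.disjoint_left.mp hXY he]
    have h₂ : ∏ e ∈ Y, (1 - G.p e) =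
        ∏ e ∈ Y, ((if e ∈ Y then 0 else G.p e) + (if e ∈ X then 0 else 1 - G.p e)) :=
      Finset.prod_congr rfl fun e he => by simp [he, Finset.disjoint_right.mp hXY he]
    rw [h₁, h₂, ← Finset.prod_union hXY]
    refine (Finset.prod_subset (Finset.union_subset hX hY) fun e _ he => ?_).symm
    simp only [Finset.mem_union, not_or] at he
    simp [he.1, he.2]
  rw [← hl, key]
  refine Finset.sum_congr rfl fun A hA => ?_
  rw [Finset.mem_powerset] at hA
  split_ifs with h
  · rw [mul_one, stateProb]
    congr 1
    · exact Finset.prod_congr rfl fun e he => by simp [Finset.disjoint_left.mp h.2 he]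
    · exact Finset.prod_congr rfl fun e he =>
        (if_neg fun hx => (Finset.mem_sdiff.mp he).2 (h.1 hx)).symm
  · rw [mul_zero, eq_comm, mul_eq_zero]
    by_cases hXA : X ⊆ A
    · left
      obtain ⟨e, he, heY⟩ := Finset.not_disjoint_iff.mp fun hd => h ⟨hXA, hd⟩
      exact Finset.prod_eq_zero he (by simp [heY])
    · right
      obtain ⟨e, he, heA⟩ := Finset.not_subset.mp hXA
      exact Finset.prod_eq_zero (Finset.mem_sdiff.mpr ⟨hX he, heA⟩) (by simp [he])

theorem sum_stateProb : ∑ A ∈ G.E.powerset, G.stateProb A = 1 := by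
  simpa using G.sum_stateProb_ite (X := ∅) (Y := ∅) (by simp) (by simp) (by simp)

theorem sum_stateProb_mem {e : U × V} (he : e ∈ G.E) :
    ∑ A ∈ G.E.powerset, G.stateProb A * (if e ∈ A then 1 else 0) = G.p e := by
  simpa using G.sum_stateProb_ite (X := {e}) (Y := ∅) (by simpa using he) (by simp) (by simp)

theorem sum_stateProb_not_disjoint {S : Finset (U × V)} (hS : S ⊆ G.E) :
    ∑ A ∈ G.E.powerset, G.stateProb A * (if Disjoint A S then 0 else 1) =
      1 - ∏ e ∈ S, (1 - G.p e) := by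
  have h := G.sum_stateProb_ite (X := ∅) (Y := S) (by simp) hS (by simp)
  simp only [Finset.empty_subset, true_and, Finset.prod_empty, one_mul] at h
  rw [← h, eq_sub_iff_add_eq, ← Finset.sum_add_distrib]
  refine (Finset.sum_congr rfl fun A _ => ?_).trans G.sum_stateProb
  split_ifs <;> ring

/-! ### Expectations of randomized probing algorithms -/

/-- The expectation of `f` of the output of a deterministic strategy. -/
def treeExpect (T : ProbingTree (U × V)) (f : Finset (U × V) → ℝ) : ℝ :=
  ∑ A ∈ G.E.powerset, G.stateProb A * f (T.output A)

theorem expect_eq (μ : PMF (ProbingTree (U × V))) (f : Finset (U × V) → ℝ) :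
    G.expect μ f = ∑' T, (μ T).toReal * G.treeExpect T f := rfl

theorem summable_toReal_pmf {β : Type*} (μ : PMF β) : Summable fun b => (μ b).toReal :=
  ENNReal.summable_toReal (by simp [μ.tsum_coe])

theorem tsum_toReal_pmf {β : Type*} (μ : PMF β) : ∑' b, (μ b).toReal = 1 := by
  rw [← ENNReal.tsum_toReal_eq fun b => μ.apply_ne_top b, μ.tsum_coe, ENNReal.toReal_one]

/-- There are only finitely many possible outputs, so the bound is uniform in `T`. This gives
summability over the infinite type of trees for every law `μ`. -/
theorem abs_treeExpect_le (T : ProbingTree (U × V)) (f : Finset (U × V) → ℝ) :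
    |G.treeExpect T f| ≤ ∑ M : Finset (U × V), |f M| := by
  calc |G.treeExpect T f|
      ≤ ∑ A ∈ G.E.powerset, |G.stateProb A * f (T.output A)| := Finset.abs_sum_le_sum_abs _ _
    _ ≤ ∑ A ∈ G.E.powerset, G.stateProb A * ∑ M : Finset (U × V), |f M| := by
        refine Finset.sum_le_sum fun A hA => ?_
        have hA := G.stateProb_nonneg (Finset.mem_powerset.mp hA)
        rw [abs_mul, abs_of_nonneg hA]
        exact mul_le_mul_of_nonneg_left
          (Finset.single_le_sum (f := fun M => |f M|) (fun _ _ => abs_nonneg _)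
            (Finset.mem_univ _)) hA
    _ = ∑ M : Finset (U × V), |f M| := by rw [← Finset.sum_mul, G.sum_stateProb, one_mul]

theorem summable_treeExpect (μ : PMF (ProbingTree (U × V))) (f : Finset (U × V) → ℝ) :
    Summable fun T => (μ T).toReal * G.treeExpect T f := by
  refine Summable.of_norm_bounded ((summable_toReal_pmf μ).mul_right (∑ M, |f M|)) fun T => ?_
  rw [norm_mul, Real.norm_eq_abs, Real.norm_eq_abs, abs_of_nonneg ENNReal.toReal_nonneg]
  exact mul_le_mul_of_nonneg_left (G.abs_treeExpect_le T f) ENNReal.toReal_nonneg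

theorem expect_le_of_treeExpect_le {μ : PMF (ProbingTree (U × V))} {f : Finset (U × V) → ℝ}
    {c : ℝ} (h : ∀ T ∈ μ.support, G.treeExpect T f ≤ c) : G.expect μ f ≤ c := by
  have hc : ∑' T, (μ T).toReal * c = c := by rw [tsum_mul_right, tsum_toReal_pmf, one_mul]
  rw [expect_eq, ← hc]
  refine (G.summable_treeExpect μ f).tsum_le_tsum (fun T => ?_)
    ((summable_toReal_pmf μ).mul_right c)
  by_cases hT : T ∈ μ.support
  · exact mul_le_mul_of_nonneg_left (h T hT) ENNReal.toReal_nonneg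
  · simp [(PMF.apply_eq_zero_iff μ T).mpr hT]

theorem expect_nonneg {μ : PMF (ProbingTree (U × V))} {f : Finset (U × V) → ℝ}
    (hf : ∀ M, 0 ≤ f M) : 0 ≤ G.expect μ f :=
  tsum_nonneg fun _ => mul_nonneg ENNReal.toReal_nonneg <| Finset.sum_nonneg fun _ hA =>
    mul_nonneg (G.stateProb_nonneg (Finset.mem_powerset.mp hA)) (hf _)

theorem expect_sum_mul (μ : PMF (ProbingTree (U × V))) {ι : Type*} (S : Finset ι) (c : ι → ℝ)
    (f : ι → Finset (U × V) → ℝ) :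
    G.expect μ (fun M => ∑ i ∈ S, c i * f i M) = ∑ i ∈ S, c i * G.expect μ (f i) := by
  simp only [expect_eq]
  have h : ∀ T, (μ T).toReal * G.treeExpect T (fun M => ∑ i ∈ S, c i * f i M) =
      ∑ i ∈ S, c i * ((μ T).toReal * G.treeExpect T (f i)) := by
    intro T
    simp only [treeExpect, Finset.mul_sum]
    rw [Finset.sum_comm]
    exact Finset.sum_congr rfl fun i _ => Finset.sum_congr rfl fun A _ => by ring
  simp only [h]
  rw [Summable.tsum_finsetSum fun i _ => (G.summable_treeExpect μ (f i)).mul_left (c i)]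
  simp only [tsum_mul_left]

theorem expect_congr {μ : PMF (ProbingTree (U × V))} {f g : Finset (U × V) → ℝ}
    (h : ∀ M ⊆ G.E, f M = g M) : G.expect μ f = G.expect μ g := by
  simp only [expect_eq, treeExpect]
  refine tsum_congr fun T => congrArg _ <| Finset.sum_congr rfl fun A hA => ?_
  rw [h _ ((T.output_subset A).trans (Finset.mem_powerset.mp hA))]

/-- The probability that the edge `e` is returned. -/
noncomputable def returnProb (μ : PMF (ProbingTree (U × V))) (e : U × V) : ℝ :=
  G.expect μ (fun M => if e ∈ M then 1 else 0)

theorem expect_sum_weight (μ : PMF (ProbingTree (U × V))) (c : U × V → ℝ) :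
    G.expect μ (fun M => ∑ e ∈ M, c e) = ∑ e ∈ G.E, c e * G.returnProb μ e := by
  unfold returnProb
  rw [← G.expect_sum_mul μ G.E c]
  refine G.expect_congr fun M hM => ?_
  simp only [mul_ite, mul_one, mul_zero]
  rw [← Finset.sum_filter, Finset.filter_mem_eq_inter, Finset.inter_eq_right.mpr hM]

theorem expect_card_offline (μ : PMF (ProbingTree (U × V))) (u : U) :
    G.expect μ (fun M => ((M.filter (fun e => e.1 = u)).card : ℝ)) =
      ∑ e ∈ G.edgesOff u, G.returnProb μ e := by
  have h := G.expect_sum_weight μ (fun e => if e.1 = u then 1 else 0)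
  simp only [Finset.sum_boole, ite_mul, one_mul, zero_mul, ← Finset.sum_filter] at h
  exact h

/-! ### From relaxed probing algorithms to the query-commit program -/

theorem returnProb_nonneg (μ : PMF (ProbingTree (U × V))) (e : U × V) : 0 ≤ G.returnProb μ e :=
  G.expect_nonneg fun M => by split_ifs <;> norm_num

theorem returnProb_le (μ : PMF (ProbingTree (U × V))) {e : U × V} (he : e ∈ G.E) :
    G.returnProb μ e ≤ G.p e := by
  refine G.expect_le_of_treeExpect_le fun T _ => ?_
  rw [← G.sum_stateProb_mem he]
  refine Finset.sum_le_sum fun A hA => mul_le_mul_of_nonneg_left ?_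
    (G.stateProb_nonneg (Finset.mem_powerset.mp hA))
  by_cases h : e ∈ T.output A
  · simp [h, T.output_subset A h]
  · simp only [h, if_false]
    split_ifs <;> norm_num

/-- The inequality holds state by state: the number of returned edges in `S` is at most the
indicator that `S` contains an active edge. -/
theorem sum_returnProb_le {μ : PMF (ProbingTree (U × V))}
    (hμ : ∀ T ∈ μ.support, G.Admissible T) {v : V} {S : Finset (U × V)} (hS : S ⊆ G.edgesOn v) :
    ∑ e ∈ S, G.returnProb μ e ≤ 1 - ∏ e ∈ S, (1 - G.p e) := by
  have h := G.expect_sum_mul μ S (fun _ => 1) (fun e M => if e ∈ M then 1 else 0)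
  simp only [one_mul] at h
  unfold returnProb
  rw [← h, ← G.sum_stateProb_not_disjoint (hS.trans (Finset.filter_subset _ _))]
  refine G.expect_le_of_treeExpect_le fun T hT => Finset.sum_le_sum fun A hA => ?_
  rw [Finset.mem_powerset] at hA
  refine mul_le_mul_of_nonneg_left ?_ (G.stateProb_nonneg hA)
  simp only [Finset.sum_boole]
  split_ifs with hd
  · rw [Nat.cast_nonpos, Finset.card_eq_zero, Finset.filter_eq_empty_iff]
    exact fun e he hM => Finset.disjoint_left.mp hd (T.output_subset A hM) he
  · refine le_trans (Nat.cast_le.mpr (Finset.card_le_card ?_))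
      (Nat.cast_le_one.mpr (hμ T hT A hA v).2)
    intro e he
    rw [Finset.mem_filter] at he ⊢
    exact ⟨he.2, (Finset.mem_filter.mp (hS he.1)).2⟩

variable {G} in
theorem mem_E_of_mem_edgesOff {u : U} {e : U × V} (he : e ∈ G.edgesOff u) : e ∈ G.E :=
  (Finset.mem_filter.mp he).1

theorem relaxedValues_subset_qcValues : G.relaxedValues ⊆ G.qcValues := by
  rintro _ ⟨μ, hμ, rfl⟩
  -- When `p e = 0` the quotient is 0 by convention, and the return probability vanishes as well,
  -- being at most `p e`.
  have hx : ∀ e ∈ G.E, G.p e * (G.returnProb μ e / G.p e) = G.returnProb μ e := by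
    intro e he
    refine mul_div_cancel_of_imp' fun h => le_antisymm ?_ (G.returnProb_nonneg μ e)
    exact h ▸ G.returnProb_le μ he
  refine ⟨fun e => G.returnProb μ e / G.p e, ⟨fun v S hS => ?_, fun u => ?_, fun e he => ?_⟩, ?_⟩
  · rw [Finset.sum_congr rfl fun e he => hx e (Finset.mem_filter.mp (hS he)).1]
    exact G.sum_returnProb_le hμ.admissible hS
  · rw [Finset.sum_congr rfl fun e he => hx e (mem_E_of_mem_edgesOff he),
      ← G.expect_card_offline]
    exact hμ.offline u
  · exact div_nonneg (G.returnProb_nonneg μ e) (G.p_nonneg e he)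
  · rw [G.expect_sum_weight, qcObjective]
    exact Finset.sum_congr rfl fun e he => by rw [mul_assoc, hx e he]

/-! ### Edge marginals of the configuration program -/

/-- The probability that `e` is the first active edge of the string `s`. -/
def firstProb (s : List (U × V)) (e : U × V) : ℝ :=
  if e ∈ s then G.p e * G.q (before s e) else 0

/-- The total probability that `e` is the first active edge, if the string of its online vertex is
drawn according to `x`. -/
def configMarginal (x : V → List (U × V) → ℝ) (e : U × V) : ℝ :=
  ∑ s ∈ G.C e.2, G.firstProb s e * x e.2 s

variable {G} in
theorem nodup_of_mem_C {v : V} {s : List (U × V)} (hs : s ∈ G.C v) : s.Nodup :=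
  (mem_distinctStrings.mp (G.C_subset v hs)).1

variable {G} in
theorem mem_edgesOn_of_mem_C {v : V} {s : List (U × V)} (hs : s ∈ G.C v) {e : U × V}
    (he : e ∈ s) : e ∈ G.edgesOn v :=
  (mem_distinctStrings.mp (G.C_subset v hs)).2 e he

theorem configMarginal_of_notMem (x : V → List (U × V) → ℝ) {e : U × V} (he : e ∉ G.E) :
    G.configMarginal x e = 0 := by
  refine Finset.sum_eq_zero fun s hs => ?_
  rw [firstProb, if_neg fun h => he (Finset.mem_filter.mp (mem_edgesOn_of_mem_C hs h)).1, zero_mul]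

theorem config_offline_eq (x : V → List (U × V) → ℝ) (u : U) :
    ∑ v : V, ∑ s ∈ (G.C v).filter (fun s => (u, v) ∈ s),
      G.p (u, v) * G.q (before s (u, v)) * x v s = ∑ e ∈ G.edgesOff u, G.configMarginal x e := by
  have h : ∀ v, ∑ s ∈ (G.C v).filter (fun s => (u, v) ∈ s),
      G.p (u, v) * G.q (before s (u, v)) * x v s = G.configMarginal x (u, v) := by
    intro v
    simp only [configMarginal, firstProb, ite_mul, zero_mul]
    rw [Finset.sum_filter]
  simp only [h, edgesOff]
  rw [Finset.sum_filter, Finset.sum_subset (Finset.subset_univ G.E), Fintype.sum_prod_type,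
    Finset.sum_eq_single u]
  · simp
  · intro u' _ hu
    simp [hu]
  · simp
  · intro e _ he
    simp [G.configMarginal_of_notMem x he]

theorem val_eq_sum_firstProb {v : V} {s : List (U × V)} (hs : s ∈ G.C v) :
    G.val s = ∑ e, G.w e * G.firstProb s e := by
  rw [val, ← List.sum_toFinset _ (nodup_of_mem_C hs)]
  refine Eq.trans ?_ (Finset.sum_subset (Finset.subset_univ s.toFinset) fun e _ he => ?_)
  · exact Finset.sum_congr rfl fun e he => by
      rw [firstProb, if_pos (List.mem_toFinset.mp he), mul_assoc]
  · rw [firstProb, if_neg fun h => he (List.mem_toFinset.mpr h), mul_zero]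

theorem configObjective_eq (x : V → List (U × V) → ℝ) :
    G.configObjective x = ∑ e ∈ G.E, G.w e * G.configMarginal x e := by
  rw [Finset.sum_subset (Finset.subset_univ G.E)
    fun e _ he => by rw [G.configMarginal_of_notMem x he, mul_zero], configObjective,
    Fintype.sum_prod_type_right]
  refine Finset.sum_congr rfl fun v _ => ?_
  simp only [configMarginal, Finset.mul_sum]
  rw [Finset.sum_comm]
  refine Finset.sum_congr rfl fun s hs => ?_
  rw [G.val_eq_sum_firstProb hs, Finset.sum_mul, Fintype.sum_prod_type_right,
    Finset.sum_eq_single v]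
  · exact Finset.sum_congr rfl fun u _ => by ring
  · intro v' _ hv
    refine Finset.sum_eq_zero fun u _ => ?_
    rw [firstProb, if_neg fun h => hv (Finset.mem_filter.mp (mem_edgesOn_of_mem_C hs h)).2]
    ring
  · simp

/-! ### From the configuration program to relaxed probing algorithms -/

omit [Fintype U] [Fintype V] in
-- The right-hand side has the shape of the event in `sum_stateProb_ite`, with `X = {e}` and `Y` the
-- edges before `e`.
theorem find?_eq_some_iff_before {A : Finset (U × V)} {s : List (U × V)} {e : U × V} :
    s.find? (fun f => decide (f ∈ A)) = some e ↔
      e ∈ s ∧ ({e} ⊆ A ∧ Disjoint A (before s e).toFinset) := by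
  induction s with
  | nil => simp
  | cons f s ih =>
    by_cases hfe : f = e
    · subst hfe
      by_cases hf : f ∈ A
      · simp [hf, before]
      · simp [hf, before, ih]
    · by_cases hf : f ∈ A
      · simp [hf, before, hfe]
      · have hfe' : ¬ e = f := fun h => hfe h.symm
        simp only [before] at ih
        simp [hf, before, hfe, hfe', ih]

theorem sum_stateProb_find? {v : V} {s : List (U × V)} (hs : s ∈ G.C v) (e : U × V) :
    ∑ A ∈ G.E.powerset, G.stateProb A *
      (if s.find? (fun f => decide (f ∈ A)) = some e then 1 else 0) = G.firstProb s e := by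
  simp only [find?_eq_some_iff_before, firstProb]
  split_ifs with he
  · have hE : ∀ f ∈ s, f ∈ G.E := fun f hf =>
      (Finset.mem_filter.mp (mem_edgesOn_of_mem_C hs hf)).1
    have hsub : (before s e).Sublist s := List.takeWhile_sublist _
    have hne : e ∉ before s e := fun h => by
      simpa using List.mem_takeWhile_imp h
    have h := G.sum_stateProb_ite (X := {e}) (Y := (before s e).toFinset)
      (by simpa using hE e he) (fun f hf => hE f (hsub.subset (List.mem_toFinset.mp hf)))
      (by simpa using hne)
    rw [Finset.prod_singleton, List.prod_toFinset _ ((nodup_of_mem_C hs).sublist hsub)] at h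
    simpa only [he, true_and, q] using h
  · simp [he]

/-- The strategy that probes the string `σ v` for every online vertex `v` and commits to the first
active edge. -/
noncomputable def stringTree (σ : V → List (U × V)) : ProbingTree (U × V) :=
  ProbingTree.probeAll σ Finset.univ.toList

variable {G} in
theorem mem_output_stringTree {σ : V → List (U × V)} (hσ : ∀ v, σ v ∈ G.C v)
    {A : Finset (U × V)} {e : U × V} :
    e ∈ (stringTree σ).output A ↔
      (σ e.2).find? (fun f => decide (f ∈ A)) = some e := by
  rw [stringTree, ProbingTree.mem_output_probeAll]
  constructor
  · rintro ⟨v, -, hv⟩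
    rwa [(Finset.mem_filter.mp (mem_edgesOn_of_mem_C (hσ v) (List.mem_of_find?_eq_some hv))).2]
  · exact fun h => ⟨e.2, by simp, h⟩

theorem admissible_stringTree {σ : V → List (U × V)} (hσ : ∀ v, σ v ∈ G.C v) :
    G.Admissible (stringTree σ) := by
  intro A _ v
  constructor
  · refine G.C_downward_closed v _ (hσ v) _ (List.Sublist.subperm ?_)
    exact (ProbingTree.filter_probes_probeAll (π := Prod.snd)
      (fun v e he => (Finset.mem_filter.mp (mem_edgesOn_of_mem_C (hσ v) he)).2)
      (Finset.nodup_toList _) A v).1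
  · rw [Finset.card_le_one]
    intro e he f hf
    rw [Finset.mem_filter, mem_output_stringTree hσ] at he hf
    rw [he.2] at he
    rw [hf.2] at hf
    exact Option.some_injective _ (he.1.symm.trans hf.1)

theorem treeExpect_stringTree {σ : V → List (U × V)} (hσ : ∀ v, σ v ∈ G.C v) (e : U × V) :
    G.treeExpect (stringTree σ) (fun M => if e ∈ M then 1 else 0) = G.firstProb (σ e.2) e := by
  simp only [treeExpect, mem_output_stringTree hσ]
  exact G.sum_stateProb_find? (hσ e.2) e

/-- Expectation under a finitely supported law of strategies. -/
theorem expect_map_of_support {ι : Type*} (ν : PMF ι) (F : Finset ι) (hF : ∀ i ∉ F, ν i = 0)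
    (t : ι → ProbingTree (U × V)) (f : Finset (U × V) → ℝ) :
    G.expect (ν.map t) f = ∑ i ∈ F, (ν i).toReal * G.treeExpect (t i) f := by
  classical
  have h : ∀ T, ((ν.map t) T).toReal * G.treeExpect T f =
      ∑ i ∈ F, if T = t i then (ν i).toReal * G.treeExpect (t i) f else 0 := by
    intro T
    rw [PMF.map_apply, tsum_eq_sum (s := F) fun i hi => by simp [hF i hi],
      ENNReal.toReal_sum fun i _ => by split_ifs <;> simp [ν.apply_ne_top], Finset.sum_mul]
    refine Finset.sum_congr rfl fun i _ => ?_
    by_cases hT : T = t i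
    · simp [hT]
    · simp [hT]
  rw [expect_eq, tsum_congr h, Summable.tsum_finsetSum]
  · simp
  · exact fun i _ => (hasSum_ite_eq (t i) _).summable

/-- Marginals of a product law: insert `h` into the factor `i₀` of a product of sums; every other
factor sums to 1. -/
theorem sum_piFinset_prod_mul {ι β : Type*} [Fintype ι] [DecidableEq ι] (C : ι → Finset β)
    (x : ι → β → ℝ) (hx : ∀ i, ∑ s ∈ C i, x i s = 1) (i₀ : ι) (h : β → ℝ) :
    ∑ σ ∈ Fintype.piFinset C, (∏ i, x i (σ i)) * h (σ i₀) = ∑ s ∈ C i₀, h s * x i₀ s := by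
  have key := Finset.prod_univ_sum C (fun i s => x i s * if i = i₀ then h s else 1)
  have hr : ∀ σ : ι → β, ∏ i, (x i (σ i) * if i = i₀ then h (σ i) else 1) =
      (∏ i, x i (σ i)) * h (σ i₀) := by
    intro σ
    rw [Finset.prod_mul_distrib, Finset.prod_ite_eq' Finset.univ i₀ fun i => h (σ i)]
    simp
  simp only [hr] at key
  rw [← key, Finset.prod_eq_single i₀]
  · exact Finset.sum_congr rfl fun s _ => by rw [if_pos rfl, mul_comm]
  · intro i _ hi
    simp [hi, hx]
  · simp

theorem exists_relaxed_of_configFeasible {x : V → List (U × V) → ℝ} (hx : G.ConfigFeasible x) :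
    ∃ μ : PMF (ProbingTree (U × V)), (∀ T ∈ μ.support, G.Admissible T) ∧
      ∀ e, G.returnProb μ e = G.configMarginal x e := by
  classical
  have hnn : ∀ σ ∈ Fintype.piFinset G.C, 0 ≤ ∏ v, x v (σ v) := fun σ hσ =>
    Finset.prod_nonneg fun v _ => hx.nonneg v _ (Fintype.mem_piFinset.mp hσ v)
  have hsum : ∑ σ ∈ Fintype.piFinset G.C, ∏ v, x v (σ v) = 1 := by
    rw [← Finset.prod_univ_sum]
    exact Finset.prod_eq_one fun v _ => hx.online v
  let ν : PMF (V → List (U × V)) := PMF.ofFinset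
    (fun σ => if σ ∈ Fintype.piFinset G.C then ENNReal.ofReal (∏ v, x v (σ v)) else 0)
    (Fintype.piFinset G.C)
    (by rw [Finset.sum_congr rfl fun σ hσ => if_pos hσ, ← ENNReal.ofReal_sum_of_nonneg hnn, hsum,
          ENNReal.ofReal_one])
    (fun σ hσ => if_neg hσ)
  have hν : ∀ σ, ν σ = if σ ∈ Fintype.piFinset G.C then ENNReal.ofReal (∏ v, x v (σ v)) else 0 :=
    fun σ => rfl
  refine ⟨ν.map stringTree, fun T hT => ?_, fun e => ?_⟩
  · obtain ⟨σ, hσ, rfl⟩ := (PMF.mem_support_map_iff _ _ _).mp hT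
    refine G.admissible_stringTree (Fintype.mem_piFinset.mp ?_)
    by_contra h
    exact (PMF.mem_support_iff _ _).mp hσ (by rw [hν, if_neg h])
  · rw [returnProb, G.expect_map_of_support ν (Fintype.piFinset G.C)
      (fun σ hσ => by rw [hν, if_neg hσ]), configMarginal,
      ← sum_piFinset_prod_mul G.C x hx.online e.2 (fun s => G.firstProb s e)]
    refine Finset.sum_congr rfl fun σ hσ => ?_
    rw [G.treeExpect_stringTree (Fintype.mem_piFinset.mp hσ), hν, if_pos hσ,
      ENNReal.toReal_ofReal (hnn σ hσ)]

theorem configValues_subset_relaxedValues : G.configValues ⊆ G.relaxedValues := by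
  rintro _ ⟨x, hx, rfl⟩
  obtain ⟨μ, hμ, hμx⟩ := G.exists_relaxed_of_configFeasible hx
  refine ⟨μ, ⟨hμ, fun u => ?_⟩, ?_⟩
  · rw [G.expect_card_offline, Finset.sum_congr rfl fun e _ => hμx e, ← G.config_offline_eq]
    exact hx.offline u
  · rw [G.expect_sum_weight, G.configObjective_eq]
    exact Finset.sum_congr rfl fun e _ => by rw [hμx e]

/-! ### From the query-commit program to the configuration program -/

/-- Optimality of the greedy order: if all prefix sums of `y` along `l` are bounded by the
probability that the prefix has an active edge (up to a factor `Q` and a slack `D`), then the same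
holds with nonincreasing nonnegative weights `c`. -/
theorem sum_le_sum_greedy (c y : U × V → ℝ) (l : List (U × V)) (hl : l.Nodup)
    (hc : l.Pairwise fun a b => c b ≤ c a) (hc0 : ∀ e ∈ l, 0 ≤ c e) (Q D K : ℝ) (hD : 0 ≤ D)
    (hK : 0 ≤ K) (hcK : ∀ e ∈ l, c e ≤ K)
    (h : ∀ t, t <+: l → (t.map y).sum ≤ D + Q * (1 - G.q t)) :
    (l.map fun e => c e * y e).sum ≤
      K * D + Q * (l.map fun e => c e * (G.p e * G.q (before l e))).sum := by
  induction l generalizing Q D K with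
  | nil => simpa using mul_nonneg hK hD
  | cons a l ih =>
    obtain ⟨hal, hl⟩ := List.nodup_cons.mp hl
    obtain ⟨hca, hc⟩ := List.pairwise_cons.mp hc
    have ha := h [a] (by simp)
    simp only [List.map_cons, List.map_nil, List.sum_cons, List.sum_nil, add_zero, q,
      List.prod_cons, List.prod_nil, mul_one] at ha
    -- Since `1 - q (a :: t) = p a + (1 - p a) * (1 - q t)`, removing `a` scales `Q` by `1 - p a`
    -- and leaves the slack `D + Q * p a - y a`, nonnegative by the prefix `[a]`. Later edges can
    -- use this slack only at weight at most `c a`, the new `K`.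
    have ih := ih hl hc (fun e he => hc0 e (List.mem_cons_of_mem _ he)) (Q * (1 - G.p a))
      (D + Q * G.p a - y a) (c a) (by linarith) (hc0 a (by simp)) hca (fun t ht => by
        have := h (a :: t) (by simpa using ht)
        simp only [List.map_cons, List.sum_cons, q, List.prod_cons] at this ⊢
        linarith)
    have hb : (l.map fun e => c e * (G.p e * G.q (before (a :: l) e))).sum =
        (1 - G.p a) * (l.map fun e => c e * (G.p e * G.q (before l e))).sum := by
      rw [← List.sum_map_mul_left]
      refine congrArg List.sum (List.map_congr_left fun e he => ?_)
      have hae : a ≠ e := fun h => hal (h ▸ he)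
      have : before (a :: l) e = a :: before l e := by simp [before, hae]
      rw [this, q, List.map_cons, List.prod_cons, ← q]
      ring
    have hba : G.q (before (a :: l) a) = 1 := by simp [before, q]
    rw [List.map_cons, List.sum_cons, List.map_cons, List.sum_cons, hb, hba]
    have := mul_le_mul_of_nonneg_right (hcK a (by simp)) hD
    linarith

/-- Edges with negative `c` can be left out of the string because `y ≥ 0`. For the remaining ones in
decreasing order of `c`, the constraints on prefixes suffice. -/
theorem exists_string_weighted_sum_le {v : V} {y : U × V → ℝ}
    (hy : ∀ e, 0 ≤ y e) (hyv : ∀ e ∉ G.edgesOn v, y e = 0)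
    (h : ∀ S ⊆ G.edgesOn v, ∑ e ∈ S, y e ≤ 1 - ∏ e ∈ S, (1 - G.p e)) (c : U × V → ℝ) :
    ∃ s ∈ distinctStrings (G.edgesOn v), ∑ e, c e * y e ≤ ∑ e, c e * G.firstProb s e := by
  classical
  set S := (G.edgesOn v).filter fun e => 0 ≤ c e with hS
  set l := S.toList.insertionSort fun a b => c b ≤ c a with hl
  have hperm : l.Perm S.toList := List.perm_insertionSort _ _
  have hnd : l.Nodup := hperm.nodup_iff.mpr (Finset.nodup_toList _)
  have hmem : ∀ e, e ∈ l ↔ e ∈ S := fun e => by rw [hperm.mem_iff, Finset.mem_toList]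
  have hsorted : l.Pairwise fun a b => c b ≤ c a :=
    haveI : Std.Total fun a b : U × V => c b ≤ c a := ⟨fun a b => le_total _ _⟩
    haveI : IsTrans (U × V) fun a b => c b ≤ c a := ⟨fun _ _ _ h₁ h₂ => h₂.trans h₁⟩
    List.pairwise_insertionSort _ _
  have hsum : ∀ f : U × V → ℝ, (l.map f).sum = ∑ e ∈ S, f e := fun f => by
    rw [(hperm.map f).sum_eq, Finset.sum_map_toList]
  refine ⟨l, mem_distinctStrings.mpr
    ⟨hnd, fun f hf => (Finset.mem_filter.mp ((hmem f).mp hf)).1⟩, ?_⟩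
  -- With initial slack `D = 0` the value of `K` plays no role; `∑ |c e|` is a convenient upper
  -- bound for `c`.
  have key := G.sum_le_sum_greedy c y l hnd hsorted
    (fun e he => (Finset.mem_filter.mp ((hmem e).mp he)).2) 1 0 (∑ e, |c e|) le_rfl
    (Finset.sum_nonneg fun _ _ => abs_nonneg _)
    (fun e _ => (le_abs_self _).trans (Finset.single_le_sum (f := fun e => |c e|)
      (fun _ _ => abs_nonneg _) (Finset.mem_univ e)))
    (fun t ht => by
      have htnd : t.Nodup := hnd.sublist ht.sublist
      have := h t.toFinset fun e he =>
        (Finset.mem_filter.mp ((hmem e).mp (ht.subset (List.mem_toFinset.mp he)))).1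
      rw [List.sum_toFinset _ htnd, List.prod_toFinset _ htnd] at this
      simpa [q] using this)
  rw [hsum, hsum, mul_zero, zero_add, one_mul] at key
  calc ∑ e, c e * y e ≤ ∑ e ∈ S, c e * y e := by
        rw [← Finset.sum_add_sum_compl S, add_le_iff_nonpos_right]
        refine Finset.sum_nonpos fun e he => ?_
        by_cases hev : e ∈ G.edgesOn v
        · have : ¬ 0 ≤ c e := fun h0 =>
            Finset.mem_compl.mp he (Finset.mem_filter.mpr ⟨hev, h0⟩)
          exact mul_nonpos_of_nonpos_of_nonneg (not_le.mp this).le (hy e)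
        · rw [hyv e hev, mul_zero]
    _ ≤ _ := key
    _ = ∑ e ∈ S, c e * G.firstProb l e :=
        Finset.sum_congr rfl fun e he => by rw [firstProb, if_pos ((hmem e).mpr he)]
    _ = ∑ e, c e * G.firstProb l e :=
        Finset.sum_subset (Finset.subset_univ _) fun e _ he => by
          rw [firstProb, if_neg fun h => he ((hmem e).mp h), mul_zero]

/-- A point of a finite-dimensional space that no linear functional separates from a finite family
is a convex combination of the family. -/
theorem exists_convex_weights {ι κ : Type*} [Fintype κ] (C : Finset ι) (Y : ι → κ → ℝ)
    (y : κ → ℝ) (h : ∀ c : κ → ℝ, ∃ s ∈ C, ∑ e, c e * y e ≤ ∑ e, c e * Y s e) :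
    ∃ a : ι → ℝ, (∀ s ∈ C, 0 ≤ a s) ∧ ∑ s ∈ C, a s = 1 ∧ ∀ e, ∑ s ∈ C, Y s e * a s = y e := by
  classical
  have hy : y ∈ convexHull ℝ (Y '' C) := by
    by_contra hy
    -- The hull of a finite set is closed, so a point outside it is strictly separated; the
    -- coefficients of `f` in the standard basis then contradict `h`.
    obtain ⟨f, b, hf, hb⟩ := geometric_hahn_banach_closed_point (convex_convexHull ℝ _)
      ((C.finite_toSet.image Y).isClosed_convexHull ℝ) hy
    obtain ⟨s, hs, hle⟩ := h fun e => f (Pi.single e 1)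
    have hrep : ∀ z : κ → ℝ, f z = ∑ e, f (Pi.single e 1) * z e := by
      intro z
      have := f.toLinearMap.pi_apply_eq_sum_univ z
      simp only [ContinuousLinearMap.coe_coe, smul_eq_mul] at this
      rw [this]
      refine Finset.sum_congr rfl fun e _ => ?_
      rw [mul_comm]
      congr 2
      ext j
      simp [Pi.single_apply, eq_comm]
    have := hf (Y s) (subset_convexHull ℝ _ ⟨s, hs, rfl⟩)
    rw [hrep] at this hb
    linarith
  suffices convexHull ℝ (Y '' C) ⊆
      {z | ∃ a : ι → ℝ, (∀ s ∈ C, 0 ≤ a s) ∧ ∑ s ∈ C, a s = 1 ∧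
        ∀ e, ∑ s ∈ C, Y s e * a s = z e} from this hy
  refine convexHull_min ?_ ?_
  · rintro _ ⟨s, hs, rfl⟩
    refine ⟨fun t => if t = s then 1 else 0, fun t _ => by dsimp only; split_ifs <;> norm_num, ?_, fun e => ?_⟩
    · simpa using hs
    · simpa using fun h => absurd (Finset.mem_coe.mp hs) h
  · rintro z ⟨a, ha, ha1, haz⟩ z' ⟨a', ha', ha1', haz'⟩ r r' hr hr' hrr
    refine ⟨fun s => r * a s + r' * a' s,
      fun s hs => add_nonneg (mul_nonneg hr (ha s hs)) (mul_nonneg hr' (ha' s hs)), ?_, fun e => ?_⟩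
    · rw [Finset.sum_add_distrib, ← Finset.mul_sum, ← Finset.mul_sum, ha1, ha1']
      linarith
    · rw [Pi.add_apply, Pi.smul_apply, Pi.smul_apply, ← haz, ← haz', smul_eq_mul, smul_eq_mul,
        Finset.mul_sum, Finset.mul_sum, ← Finset.sum_add_distrib]
      exact Finset.sum_congr rfl fun s _ => by ring

theorem qcValues_subset_configValues (hG : G.Unconstrained) : G.qcValues ⊆ G.configValues := by
  rintro _ ⟨z, hz, rfl⟩
  -- The target is extended by 0 off `∂(v)`, where the first-active probabilities of strings at `v`
  -- vanish too.
  have hex : ∀ v, ∃ a : List (U × V) → ℝ, (∀ s ∈ G.C v, 0 ≤ a s) ∧ ∑ s ∈ G.C v, a s = 1 ∧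
      ∀ e, ∑ s ∈ G.C v, G.firstProb s e * a s =
        if e ∈ G.edgesOn v then G.p e * z e else 0 := by
    intro v
    refine exists_convex_weights (G.C v) G.firstProb _ fun c => ?_
    rw [hG v]
    refine G.exists_string_weighted_sum_le (fun e => ?_) (fun e he => if_neg he) (fun S hS => ?_) c
    · split_ifs with he
      · have he := (Finset.mem_filter.mp he).1
        exact mul_nonneg (G.p_nonneg e he) (hz.nonneg e he)
      · exact le_rfl
    · rw [Finset.sum_congr rfl fun e he => if_pos (hS he)]
      exact hz.online v S hS
  choose x hx0 hx1 hx using hex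
  have hm : ∀ e ∈ G.E, G.configMarginal x e = G.p e * z e := fun e he => by
    rw [configMarginal, hx, if_pos (by simp [edgesOn, he])]
  refine ⟨x, ⟨fun u => ?_, hx1, hx0⟩, ?_⟩
  · rw [G.config_offline_eq, Finset.sum_congr rfl fun e he => hm e (mem_E_of_mem_edgesOff he)]
    exact hz.offline u
  · rw [G.configObjective_eq, qcObjective]
    exact Finset.sum_congr rfl fun e he => by rw [hm e he, mul_assoc]

/-! ### Attainment -/

theorem isClosed_setOf_qcFeasible : IsClosed {x | G.QCFeasible x} := by
  have : {x | G.QCFeasible x} =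
      (⋂ v, ⋂ S, ⋂ (_ : S ⊆ G.edgesOn v),
        {x | ∑ e ∈ S, G.p e * x e ≤ 1 - ∏ e ∈ S, (1 - G.p e)}) ∩
      (⋂ u, {x | ∑ e ∈ G.edgesOff u, G.p e * x e ≤ 1}) ∩
      ⋂ e, ⋂ (_ : e ∈ G.E), {x | 0 ≤ x e} := by
    ext x
    simp only [Set.mem_inter_iff, Set.mem_iInter, Set.mem_ofPred_eq]
    exact ⟨fun h => ⟨⟨h.online, h.offline⟩, h.nonneg⟩, fun h => ⟨h.1.1, h.1.2, h.2⟩⟩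
  rw [this]
  refine ((isClosed_iInter fun v => isClosed_iInter fun S => isClosed_iInter fun _ => ?_).inter
    (isClosed_iInter fun u => ?_)).inter (isClosed_iInter fun e => isClosed_iInter fun _ => ?_)
  · exact isClosed_le (by fun_prop) continuous_const
  · exact isClosed_le (by fun_prop) continuous_const
  · exact isClosed_le continuous_const (by fun_prop)

theorem qcFeasible_zero : G.QCFeasible 0 := by
  refine ⟨fun v S hS => ?_, fun u => by simp, fun e _ => le_rfl⟩
  have : ∏ e ∈ S, (1 - G.p e) ≤ 1 := Finset.prod_le_one
    (fun e he => sub_nonneg.mpr (G.p_le_one e (Finset.mem_filter.mp (hS he)).1))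
    (fun e he => sub_le_self _ (G.p_nonneg e (Finset.mem_filter.mp (hS he)).1))
  simpa using this

/-- The feasible region itself may be unbounded, but only in coordinates off `E` or with `p e = 0`,
which affect neither the objective nor the sums in the constraints and can be set to 0. For the
others, the constraint for `S = {e}` gives `x e ≤ 1`. -/
theorem qcValues_eq_image :
    G.qcValues = G.qcObjective '' ({x | G.QCFeasible x} ∩ Set.Icc 0 1) := by
  refine Set.Subset.antisymm ?_ ?_
  · rintro _ ⟨x, hx, rfl⟩
    let x' : U × V → ℝ := fun e => if e ∈ G.E ∧ G.p e ≠ 0 then x e else 0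
    have hx' : ∀ e ∈ G.E, G.p e * x' e = G.p e * x e := by
      intro e he
      by_cases hp : G.p e = 0 <;> simp [x', he, hp]
    have hnn : ∀ e, 0 ≤ x' e := fun e => by
      simp only [x']
      split_ifs with h
      · exact hx.nonneg e h.1
      · exact le_rfl
    refine ⟨x', ⟨⟨fun v S hS => ?_, fun u => ?_, fun e _ => hnn e⟩, hnn, fun e => ?_⟩, ?_⟩
    · rw [Finset.sum_congr rfl fun e he => hx' e (Finset.mem_filter.mp (hS he)).1]
      exact hx.online v S hS
    · rw [Finset.sum_congr rfl fun e he => hx' e (mem_E_of_mem_edgesOff he)]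
      exact hx.offline u
    · simp only [x', Pi.one_apply]
      split_ifs with h
      · have := hx.online e.2 {e} (by simp [edgesOn, h.1])
        simp only [Finset.sum_singleton, Finset.prod_singleton, sub_sub_cancel] at this
        exact le_of_mul_le_mul_left (by simpa using this)
          (lt_of_le_of_ne (G.p_nonneg e h.1) (Ne.symm h.2))
      · exact zero_le_one
    · exact Finset.sum_congr rfl fun e he => by rw [mul_assoc, hx' e he, mul_assoc]
  · rintro _ ⟨x, hx, rfl⟩
    exact ⟨x, hx.1, rfl⟩

theorem isGreatest_qcValues : IsGreatest G.qcValues G.LPOPTQC := by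
  have hcomp : IsCompact G.qcValues := by
    rw [qcValues_eq_image]
    exact (isCompact_Icc.inter_left G.isClosed_setOf_qcFeasible).image
      (by unfold qcObjective; fun_prop)
  exact hcomp.isGreatest_sSup ⟨_, 0, G.qcFeasible_zero, rfl⟩

end StochasticGraph

theorem mainTheorem12 {U V : Type*} [Fintype U] [DecidableEq U] [Fintype V] [DecidableEq V]
    (G : StochasticGraph U V) (hG : G.Unconstrained) :
    IsGreatest G.qcValues G.LPOPTQC ∧
    IsGreatest G.configValues G.LPOPT ∧
    IsGreatest G.relaxedValues G.OPTrel ∧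
    G.LPOPTQC = G.LPOPT ∧
    G.LPOPT = G.OPTrel := by
  have hqc := G.qcValues_subset_configValues hG
  have hcr := G.configValues_subset_relaxedValues
  have hrq := G.relaxedValues_subset_qcValues
  -- The cycle of inclusions makes the three value sets equal, so the maximum of the query-commit
  -- program is the maximum of all three.
  have h₁ : G.configValues = G.qcValues := (hcr.trans hrq).antisymm hqc
  have h₂ : G.relaxedValues = G.qcValues := hrq.antisymm (hqc.trans hcr)
  have h := G.isGreatest_qcValues
  have h₃ : G.LPOPTQC = G.LPOPT := by rw [StochasticGraph.LPOPT, h₁, StochasticGraph.LPOPTQC]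
  have h₄ : G.LPOPTQC = G.OPTrel := by rw [StochasticGraph.OPTrel, h₂, StochasticGraph.LPOPTQC]
  rw [h₁, h₂, ← h₃, ← h₄]
  exact ⟨h, h, h, rfl, rfl⟩
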